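/- Let $Q$ be a finite quiver (finite directed graph, multiple arrows allowed, no loops) with vertex set $Q_0$ and arrow set $Q_1$, where $a\in Q_1$ has tail $a^-$ and head $a^+$; let $\theta\in\mathbb{Z}^{Q_0}$ and $\ell,u\in\mathbb{N}_0^{Q_1}$, and let $$\nabla(Q,\theta,\ell,u)=\Big\{x\in\mathbb{R}^{Q_1} : \sum_{a^+=v}x(a)-\sum_{a^-=v}x(a)=\theta(v)\ \ \forall v\in Q_0,\quad \ell(a)\le x(a)\le u(a)\ \ \forall a\in Q_1\Big\}.$$ A flow polytope is a lattice polytope $\nabla\subset\mathbb{R}^n$ that is equivalent to some $\nabla(Q,\theta,\ell,u)$, meaning that there is an affine isomorphism from the affine span of $\nabla$ to that of $\nabla(Q,\theta,\ell,u)$ which maps the integer points of the first affine span onto those of the second and maps $\nabla$ onto $\nabla(Q,\theta,\ell,u)$. For a field $K$, the toric ideal $\mathcal{I}_\nabla$ is the ideal of the polynomial ring $K[t_z\mid z\in\nabla\cap\mathbb{Z}^n]$ generated by all binomials $\prod_z t_z^{\alpha(z)}-\prod_z t_z^{\beta(z)}$ with $\alpha,\beta\in\mathbb{N}_0^{\nabla\cap\mathbb{Z}^n}$,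 $\sum_z\alpha(z)z=\sum_z\beta(z)z$ and $\sum_z\alpha(z)=\sum_z\beta(z)$. Proposition. Let $K$ be a field and let $\nabla$ be a flow polytope of dimension $d$. Then there is a monomial order for which the initial ideal of $\mathcal{I}_\nabla$ (the ideal generated by the leading terms of all elements of $\mathcal{I}_\nabla$) is generated by square-free monomials of degree at most $d$ if $d\neq 1$, and of degree at most $2$ if $d=1$. -/

import Mathlib

universe uι

namespace FlowToric

/-- The real vector with the integer coordinates `z`. -/
def intToReal {ι : Type*} (z : ι → ℤ) : ι → ℝ := fun i => (z i : ℝ)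

/-- The lattice `ℤ^ι` inside `ℝ^ι`. -/
def integerLattice (ι : Type*) : Set (ι → ℝ) := Set.range (intToReal (ι := ι))

/-- Equivalence of lattice polytopes `P ⊆ ℝ^ι` and `P' ⊆ ℝ^κ`: an affine isomorphism from
`AffSpan P` to `AffSpan P'` which maps the lattice points of `AffSpan P` onto those of `AffSpan P'`
and maps `P` onto `P'`. The isomorphism is given as the restriction of an affine map of the ambient
spaces (every affine map between affine subspaces is such a restriction). -/
def LatticeEquivalent {ι κ : Type*} (P : Set (ι → ℝ)) (P' : Set (κ → ℝ)) : Prop :=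
  ∃ φ : (ι → ℝ) →ᵃ[ℝ] (κ → ℝ),
    Set.BijOn φ (affineSpan ℝ P : Set (ι → ℝ)) (affineSpan ℝ P' : Set (κ → ℝ)) ∧
    φ '' ((affineSpan ℝ P : Set (ι → ℝ)) ∩ integerLattice ι) =
      (affineSpan ℝ P' : Set (κ → ℝ)) ∩ integerLattice κ ∧
    φ '' P = P'

/-- The dimension of (the affine span of) `P`. -/
noncomputable def polytopeDim {ι : Type*} (P : Set (ι → ℝ)) : ℕ :=
  Module.finrank ℝ (vectorSpan ℝ P)

open scoped Classical in
/-- The affine space `𝒜(Q, θ)`: at each vertex, inflow minus outflow is `θ`. An arrow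
`a : Quiver.Total V` has tail `a.left` and head `a.right`. -/
def flowSpace (V : Type*) [Quiver V] [Fintype (Quiver.Total V)] (θ : V → ℤ) :
    Set (Quiver.Total V → ℝ) :=
  {x | ∀ v : V, (∑ a : Quiver.Total V with a.right = v, x a)
      - (∑ a : Quiver.Total V with a.left = v, x a) = (θ v : ℝ)}

/-- The flow polytope `∇(Q, θ, ℓ, u)`. -/
def flowPolytope (V : Type*) [Quiver V] [Fintype (Quiver.Total V)] (θ : V → ℤ)
    (l u : Quiver.Total V → ℕ) : Set (Quiver.Total V → ℝ) :=
  {x | x ∈ flowSpace V θ ∧ ∀ a, (l a : ℝ) ≤ x a ∧ x a ≤ (u a : ℝ)}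

/-- The lattice points of `P`, which label the variables of the polynomial ring. -/
def LatticePoint {ι : Type*} (P : Set (ι → ℝ)) : Type _ := {z : ι → ℤ // intToReal z ∈ P}

/-- The toric ideal `ℐ_P`, generated by the binomials `t^α - t^β` with
`∑ α(z) z = ∑ β(z) z` and `∑ α(z) = ∑ β(z)`. -/
noncomputable def toricIdeal (K : Type*) [Field K] {ι : Type*} (P : Set (ι → ℝ)) :
    Ideal (MvPolynomial (LatticePoint P) K) :=
  Ideal.span {f | ∃ α β : LatticePoint P →₀ ℕ,
    (α.sum fun z n => n • z.1) = (β.sum fun z n => n • z.1) ∧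
    (α.sum fun _ n => n) = (β.sum fun _ n => n) ∧
    f = MvPolynomial.monomial α 1 - MvPolynomial.monomial β 1}

/-- The initial ideal of `I` with respect to the monomial order `m`: the ideal generated by the
leading terms of all elements of `I`. -/
noncomputable def initialIdeal {σ K : Type*} [Field K] (m : MonomialOrder σ) (I : Ideal (MvPolynomial σ K)) :
    Ideal (MvPolynomial σ K) :=
  Ideal.span ((fun f => m.leadingTerm f) '' (I : Set (MvPolynomial σ K)))

end FlowToric

/-! Call two monomials equivalent if they have the same degree and the same sum of labels. The
initial ideal of the binomial ideal is spanned by the nonstandard monomials, those not minimal in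
their class (`initialIdeal_span_binomial`). It suffices that every divisibility-minimal nonstandard
monomial is square-free of small degree.

The order compares the convex weight `∑ z(a)²` first and breaks ties by reverse lexicographic order.
By integer decomposition of flows (`exists_flow_decomposition`), a product of two labels which
differ by at least 2 in some coordinate is nonstandard: their sum splits again inside the unit cell
around their midpoint, with smaller weight (`nonstandard_pair`). This gives degree 2.

Any other minimal nonstandard monomial has its labels `F` in one unit cell, where the weight depends
only on the class, so the tie-break decides. There it is nonstandard because of a label `p` of the
cell, below all of `F`, agreeing in each coordinate with some member of `F`
(`exists_below_of_minimal`). Conversely such a `p` makes `∏ F` nonstandard, since `∑ F - p`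
decomposes inside the cell (`nonstandard_squarefreeMonomial`). Hence the monomial is `∏ F`, and by
minimality every `w ∈ F` is the only member agreeing with `p` in some coordinate. Then `F ∪ {p}` is
affinely independent, so `|F| ≤ d`. -/

namespace FlowToric

/-! ### Weighted reverse lexicographic orders -/

open Finsupp

/-- The order-defining map of the weighted reverse lexicographic order: the total weight (each
variable `z` weighing `w z + 1`), then the reversed lexicographic comparison. -/
noncomputable def weightKey {σ : Type*} [LinearOrder σ] (w : σ → ℕ) :
    (σ →₀ ℕ) →+ ℕ ×ₗ (Lex (σ →₀ ℕ))ᵒᵈ where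
  toFun α := toLex (linearCombination ℕ (fun z => w z + 1) α, OrderDual.toDual (toLex α))
  map_zero' := by
    simp
  map_add' α β := by
    simp
    rfl

theorem weightKey_injective {σ : Type*} [LinearOrder σ] (w : σ → ℕ) :
    Function.Injective (weightKey w) := by
  intro α β h
  simpa [weightKey] using congrArg (fun x => (ofLex x).2) h

/-- The summand 1 makes every variable weigh something, so a proper multiple is decided by weight
before the reversed comparison is consulted. -/
theorem weightKey_monotone {σ : Type*} [LinearOrder σ] (w : σ → ℕ) :
    Monotone (weightKey w) := by
  intro α β h
  obtain ⟨γ, rfl⟩ := exists_add_of_le h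
  rcases eq_or_ne γ 0 with rfl | hγ
  · simp
  · refine Prod.Lex.toLex_le_toLex.2 (Or.inl ?_)
    obtain ⟨z, hz⟩ := Finsupp.ne_iff.1 hγ
    have : 0 < linearCombination ℕ (fun z => w z + 1) γ := by
      rw [linearCombination_apply, Finsupp.sum]
      refine Finset.sum_pos' (fun _ _ => Nat.zero_le _) ⟨z, by simpa using hz, ?_⟩
      have : 0 < γ z := Nat.pos_of_ne_zero (by simpa using hz)
      simp [this]
    simp only [map_add]
    omega

/-- The weighted reverse lexicographic order. -/
noncomputable def weightedRevLex {σ : Type uι} [LinearOrder σ] [Finite σ] (w : σ → ℕ) :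
    MonomialOrder.{uι, uι} σ where
  syn := AddMonoidHom.mrange (weightKey w)
  addCommMonoidSyn := (AddMonoidHom.mrange (weightKey w)).toAddCommMonoid
  toSyn :=
    { Equiv.ofBijective (weightKey w).mrangeRestrict
        ⟨fun α β h => weightKey_injective w (congrArg Subtype.val h),
          (weightKey w).mrangeRestrict_surjective⟩ with
      map_add' := fun α β => Subtype.ext ((weightKey w).map_add α β) }
  toSyn_monotone := fun α β h => weightKey_monotone w h
  wellFoundedLT_syn := by
    -- Dickson's lemma passes to the monotone image of `σ →₀ ℕ`. The order dual in the full codomain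
    -- is not well-founded in general, hence the restriction to the range.
    have : WellQuasiOrderedLE (AddMonoidHom.mrange (weightKey w)) :=
      Monotone.wellQuasiOrderedLE_of_wellQuasiOrderedLE_of_surjective (α := σ →₀ ℕ)
        (f := (weightKey w).mrangeRestrict)
        (fun α β h => weightKey_monotone w h) (weightKey w).mrangeRestrict_surjective
    infer_instance

theorem weightedRevLex_lt_iff {σ : Type uι} [LinearOrder σ] [Finite σ] (w : σ → ℕ)
    {α β : σ →₀ ℕ} :
    (weightedRevLex w).toSyn β < (weightedRevLex w).toSyn α ↔
      linearCombination ℕ (fun z => w z + 1) β < linearCombination ℕ (fun z => w z + 1) α ∨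
      linearCombination ℕ (fun z => w z + 1) β = linearCombination ℕ (fun z => w z + 1) α ∧
        ∃ p, (∀ q < p, α q = β q) ∧ α p < β p := by
  change weightKey w β < weightKey w α ↔ _
  refine Prod.Lex.toLex_lt_toLex.trans (or_congr Iff.rfl (and_congr Iff.rfl ?_))
  exact Finsupp.Lex.lt_iff

/-- With equal weights, a monomial containing a variable below all variables of `α` is smaller
than `α`. -/
theorem weightedRevLex_lt_of_mem {σ : Type uι} [LinearOrder σ] [Finite σ] (w : σ → ℕ)
    {α β : σ →₀ ℕ}
    (hw : linearCombination ℕ (fun z => w z + 1) β = linearCombination ℕ (fun z => w z + 1) α)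
    {p : σ} (hp : p ∈ β.support) (hα : ∀ z ∈ α.support, p < z) :
    (weightedRevLex w).toSyn β < (weightedRevLex w).toSyn α := by
  refine (weightedRevLex_lt_iff w).2 (Or.inr ⟨hw, β.support.min' ⟨p, hp⟩, ?_, ?_⟩)
  · intro q hq
    have h1 : β q = 0 := by
      by_contra h
      exact absurd (β.support.min'_le q (by simpa using h)) (not_le.2 hq)
    have h2 : α q = 0 := by
      by_contra h
      exact absurd (hα q (by simpa using h))
        (not_lt.2 (hq.le.trans (β.support.min'_le p hp)))
    rw [h1, h2]
  · have h1 := β.support.min'_mem ⟨p, hp⟩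
    have h2 : α (β.support.min' ⟨p, hp⟩) = 0 := by
      by_contra h
      exact absurd (hα _ (by simpa using h)) (not_lt.2 (β.support.min'_le p hp))
    rw [h2]
    exact Nat.pos_of_ne_zero (by simpa using h1)

end FlowToric

/-! ### Initial ideals of binomial ideals -/

namespace FlowToric

open MvPolynomial

/-- An element of a binomial ideal whose leading monomial is `m.degree f` contains a further
monomial of the same class. -/
theorem exists_lt_of_mem_span_binomial {σ K M : Type*} [Field K] [AddCommMonoid M]
    (m : MonomialOrder σ) (c : (σ →₀ ℕ) →+ M) {f : MvPolynomial σ K}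
    (hf : f ∈ Ideal.span {f : MvPolynomial σ K | ∃ α β, c α = c β ∧
      f = monomial α 1 - monomial β 1}) (hf0 : f ≠ 0) :
    ∃ β, c β = c (m.degree f) ∧ m.toSyn β < m.toSyn (m.degree f) := by
  classical
  -- `Φ` sends a monomial to its class, so it kills the binomial ideal.
  let Φ : MvPolynomial σ K →ₐ[K] AddMonoidAlgebra K M :=
    aeval fun z => AddMonoidAlgebra.single (c (Finsupp.single z 1)) 1
  have hΦ : ∀ α a, Φ (monomial α a) = AddMonoidAlgebra.single (c α) a := by
    intro α a
    induction α using Finsupp.induction_linear generalizing a with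
    | zero =>
      simp [Φ]
    | add α β ha hb =>
      rw [← mul_one a, ← monomial_mul, map_mul, ha, hb, AddMonoidAlgebra.single_mul_single,
        map_add]
    | single z n =>
      simp only [Φ, aeval_monomial]
      simp [AddMonoidAlgebra.single_pow, AddMonoidAlgebra.single_mul_single, ← map_nsmul]
  have hker : Φ f = 0 := by
    have : Ideal.span {f : MvPolynomial σ K | ∃ α β, c α = c β ∧
        f = monomial α 1 - monomial β 1} ≤ RingHom.ker Φ := by
      rw [Ideal.span_le]
      rintro _ ⟨α, β, h, rfl⟩
      simp [RingHom.mem_ker, hΦ, h]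
    exact this hf
  by_contra! hcon
  have hsum : Φ f = ∑ s ∈ f.support, AddMonoidAlgebra.single (c s) (f.coeff s) := by
    conv_lhs => rw [f.as_sum, map_sum]
    exact Finset.sum_congr rfl fun s _ => hΦ s _
  -- If the leading monomial were minimal in its class, the coefficient of `Φ f` at that class would
  -- be the leading coefficient alone.
  have h0 := congrArg (fun x : AddMonoidAlgebra K M => x.coeff (c (m.degree f))) (hsum.symm.trans hker)
  simp at h0
  rw [Finset.sum_eq_single (m.degree f)] at h0
  · simp [hf0] at h0
  · intro s hs hne
    rw [Finsupp.single_apply, if_neg]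
    intro hc
    exact hne (m.toSyn.injective (le_antisymm (m.le_degree hs) (hcon s hc)))
  · intro h
    exact absurd (m.degree_mem_support hf0) h

/-- The initial ideal of a binomial ideal is generated by any set of monomials which are not
minimal in their class, provided that it has a divisor of each such monomial. -/
theorem initialIdeal_span_binomial {σ K M : Type*} [Field K] [AddCommMonoid M]
    (m : MonomialOrder σ) (c : (σ →₀ ℕ) →+ M) (S : Set (σ →₀ ℕ))
    (hS : ∀ s ∈ S, ∃ β, c β = c s ∧ m.toSyn β < m.toSyn s)
    (hdvd : ∀ α β, c β = c α → m.toSyn β < m.toSyn α → ∃ s ∈ S, s ≤ α) :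
    initialIdeal m (Ideal.span {f : MvPolynomial σ K | ∃ α β, c α = c β ∧
      f = monomial α 1 - monomial β 1}) = Ideal.span ((fun s => monomial s (1 : K)) '' S) := by
  classical
  refine le_antisymm (Ideal.span_le.2 ?_) (Ideal.span_le.2 ?_)
  · rintro _ ⟨f, hf, rfl⟩
    rcases eq_or_ne f 0 with rfl | hf0
    · simp
    obtain ⟨β, h1, h2⟩ := exists_lt_of_mem_span_binomial m c hf hf0
    obtain ⟨s, hs, hle⟩ := hdvd _ β h1 h2
    refine mem_ideal_span_monomial_image.2 fun x hx => ⟨s, hs, ?_⟩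
    have := support_monomial_subset hx
    rw [Finset.mem_singleton] at this
    exact this ▸ hle
  · rintro _ ⟨s, hs, rfl⟩
    obtain ⟨β, h1, h2⟩ := hS s hs
    refine Ideal.subset_span ⟨monomial s 1 - monomial β 1,
      Ideal.subset_span ⟨s, β, h1.symm, rfl⟩, ?_⟩
    have hlt : m.toSyn (m.degree (monomial β (1 : K))) <
        m.toSyn (m.degree (monomial s (1 : K))) := by simpa [m.degree_monomial] using h2
    simp only [MonomialOrder.leadingTerm]
    rw [m.degree_sub_of_lt hlt, m.leadingCoeff_sub_of_lt hlt]
    simp [m.degree_monomial]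

/-! ### Integral flows and integer decomposition -/

section Flow

variable {A V : Type*} [DecidableEq V]

/-- The incidence number of the arrow `a` (with tail `s a` and head `t a`) and the vertex `v`. -/
def incidence (s t : A → V) (a : A) (v : V) : ℤ :=
  (if t a = v then 1 else 0) - (if s a = v then 1 else 0)

theorem sum_incidence [Fintype V] (s t : A → V) (a : A) : ∑ v, incidence s t a v = 0 := by
  simp [incidence]

/-- The number of ends at `v` of arrows in `E`. -/
def endCount (s t : A → V) (E : Finset A) (v : V) : ℕ :=
  (E.filter fun a => t a = v).card + (E.filter fun a => s a = v).card

/-- A nonempty set of arrows without vertices of degree one supports a nonzero circulation. -/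
theorem exists_circulation [Fintype A] [Fintype V] (s t : A → V) (E : Finset A) (hE : E.Nonempty)
    (hdeg : ∀ v, endCount s t E v ≠ 1) :
    ∃ c : A → ℝ, c ≠ 0 ∧ (∀ a ∉ E, c a = 0) ∧ ∀ v, ∑ a, c a * (incidence s t a v : ℝ) = 0 := by
  classical
  obtain ⟨a₀, ha₀⟩ := hE
  set W : Finset V := Finset.univ.filter fun v => endCount s t E v ≠ 0 with hW
  have hcount : 2 * W.card ≤ 2 * E.card := by
    have h1 : ∑ v, endCount s t E v = 2 * E.card := by
      simp only [endCount, Finset.sum_add_distrib]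
      rw [← Finset.card_eq_sum_card_fiberwise (f := t) (by simp),
        ← Finset.card_eq_sum_card_fiberwise (f := s) (by simp)]
      ring
    rw [← h1, mul_comm, ← smul_eq_mul]
    refine (Finset.card_nsmul_le_sum W (endCount s t E) 2 fun v hv => ?_).trans
      (Finset.sum_le_sum_of_subset (Finset.subset_univ W))
    have := hdeg v
    have : endCount s t E v ≠ 0 := (Finset.mem_filter.1 hv).2
    omega
  have hv₀ : t a₀ ∈ W := by
    refine Finset.mem_filter.2 ⟨Finset.mem_univ _, ?_⟩
    have : 0 < (E.filter fun a => t a = t a₀).card :=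
      Finset.card_pos.2 ⟨a₀, Finset.mem_filter.2 ⟨ha₀, rfl⟩⟩
    simp only [endCount]
    omega
  -- Each vertex of `W` meets at least two ends, so `|W| ≤ |E|`. Conservation at all of `W` but one
  -- vertex, together with vanishing off `E`, is thus fewer than `|A|` equations; the omitted vertex
  -- follows because incidences sum to zero.
  let Φ : (A → ℝ) →ₗ[ℝ] ((W.erase (t a₀) : Finset V) → ℝ) × ((Eᶜ : Finset A) → ℝ) :=
    { toFun := fun c => (fun v => ∑ a, c a * (incidence s t a v : ℝ), fun a => c a)
      map_add' := fun c d => by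
        ext <;> simp [add_mul, Finset.sum_add_distrib]
      map_smul' := fun r c => by
        ext <;> simp [mul_assoc, Finset.mul_sum] }
  have hker : LinearMap.ker Φ ≠ ⊥ := by
    apply LinearMap.ker_ne_bot_of_finrank_lt
    rw [Module.finrank_prod, Module.finrank_fintype_fun_eq_card,
      Module.finrank_fintype_fun_eq_card, Module.finrank_fintype_fun_eq_card,
      Fintype.card_coe, Fintype.card_coe, Finset.card_compl, Finset.card_erase_of_mem hv₀]
    have h1 : 0 < W.card := Finset.card_pos.2 ⟨_, hv₀⟩
    have h2 := Finset.card_le_univ E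
    omega
  obtain ⟨c, hc, hc0⟩ := Submodule.exists_mem_ne_zero_of_ne_bot hker
  have hc1 := congrArg Prod.fst (LinearMap.mem_ker.1 hc)
  have hc2 := congrArg Prod.snd (LinearMap.mem_ker.1 hc)
  have hcE : ∀ a ∉ E, c a = 0 := fun a ha => congrFun hc2 ⟨a, Finset.mem_compl.2 ha⟩
  have hne : ∀ v, v ≠ t a₀ → ∑ a, c a * (incidence s t a v : ℝ) = 0 := by
    intro v hv
    by_cases hvW : v ∈ W
    · exact congrFun hc1 ⟨v, Finset.mem_erase.2 ⟨hv, hvW⟩⟩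
    · refine Finset.sum_eq_zero fun a _ => ?_
      by_cases ha : a ∈ E
      · have h0 : endCount s t E v = 0 := by simpa [hW] using hvW
        simp only [endCount, Nat.add_eq_zero_iff, Finset.card_eq_zero,
          Finset.filter_eq_empty_iff] at h0
        simp [incidence, h0.1 ha, h0.2 ha]
      · rw [hcE a ha, zero_mul]
  refine ⟨c, hc0, hcE, fun v => ?_⟩
  by_cases hv : v = t a₀
  · have hsum : ∑ v, ∑ a, c a * (incidence s t a v : ℝ) = 0 := by
      rw [Finset.sum_comm]
      refine Finset.sum_eq_zero fun a _ => ?_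
      rw [← Finset.mul_sum, ← Int.cast_sum, sum_incidence, Int.cast_zero, mul_zero]
    rw [Finset.sum_eq_single (t a₀) (fun v _ h => hne v h) (by simp)] at hsum
    rw [hv, hsum]
  · exact hne v hv

/-- In a real flow with integral divergence no vertex meets exactly one end of a nonintegral
arrow. -/
theorem endCount_ne_one_of_integral [Fintype A] (s t : A → V) (θ : V → ℤ) (y : A → ℝ)
    (hy : ∀ v, ∑ a, y a * (incidence s t a v : ℝ) = θ v) (E : Finset A)
    (hE : ∀ a, a ∈ E ↔ ∀ n : ℤ, y a ≠ n) (v : V) : endCount s t E v ≠ 1 := by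
  classical
  intro h1
  have hZ : ∃ n : ℤ, ∑ a ∈ E, y a * (incidence s t a v : ℝ) = n := by
    have hc : ∃ m : ℤ, ∑ a ∈ Eᶜ, y a * (incidence s t a v : ℝ) = m := by
      have : ∀ a, ∃ m : ℤ, a ∈ Eᶜ → y a = m := by
        intro a
        by_cases ha : a ∈ E
        · exact ⟨0, fun h => absurd ha (Finset.mem_compl.1 h)⟩
        · rw [hE] at ha
          push Not at ha
          obtain ⟨m, hm⟩ := ha
          exact ⟨m, fun _ => hm⟩
      choose m hm using this
      refine ⟨∑ a ∈ Eᶜ, m a * incidence s t a v, ?_⟩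
      push_cast
      exact Finset.sum_congr rfl fun a ha => by rw [hm a ha]
    obtain ⟨m, hm⟩ := hc
    refine ⟨θ v - m, ?_⟩
    have := Finset.sum_add_sum_compl E fun a => y a * (incidence s t a v : ℝ)
    rw [hy, hm] at this
    push_cast
    linarith
  obtain ⟨n, hn⟩ := hZ
  have hsplit : ∑ a ∈ E, y a * (incidence s t a v : ℝ) =
      ∑ a ∈ E.filter (fun a => t a = v), y a - ∑ a ∈ E.filter (fun a => s a = v), y a := by
    simp [incidence, mul_sub, Finset.sum_sub_distrib, Finset.sum_filter]
  rw [hsplit] at hn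
  simp only [endCount] at h1
  rcases Nat.add_eq_one_iff.1 h1 with ⟨h0, h1⟩ | ⟨h1, h0⟩
  all_goals
    rw [Finset.card_eq_zero] at h0
    obtain ⟨a, ha⟩ := Finset.card_eq_one.1 h1
    have haE : a ∈ E := Finset.filter_subset _ _ (ha ▸ Finset.mem_singleton_self a)
    rw [h0, ha, Finset.sum_empty, Finset.sum_singleton] at hn
  · exact (hE a).1 haE (-n) (by push_cast; linarith)
  · exact (hE a).1 haE n (by linarith)

/-- Hoffman's integrality theorem: if there is a real flow with integral divergence between
integral capacities, then there is an integral one. -/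
theorem exists_integral_flow [Fintype A] [Fintype V] (s t : A → V) (θ : V → ℤ) (L U : A → ℤ) (x : A → ℝ)
    (hx : ∀ v, ∑ a, x a * (incidence s t a v : ℝ) = θ v) (hxL : ∀ a, (L a : ℝ) ≤ x a)
    (hxU : ∀ a, x a ≤ U a) :
    ∃ y : A → ℤ, (∀ v, ∑ a, y a * incidence s t a v = θ v) ∧ ∀ a, L a ≤ y a ∧ y a ≤ U a := by
  classical
  set F : Set (A → ℝ) := {x | (∀ v, ∑ a, x a * (incidence s t a v : ℝ) = θ v) ∧
    x ∈ Set.Icc (fun a => (L a : ℝ)) (fun a => (U a : ℝ))} with hF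
  have hcomp : IsCompact F := by
    have hcl : IsClosed {x : A → ℝ | ∀ v, ∑ a, x a * (incidence s t a v : ℝ) = θ v} := by
      simp only [Set.ofPred_forall]
      exact isClosed_iInter fun v => isClosed_eq (by fun_prop) continuous_const
    exact (isCompact_Icc (a := fun a => (L a : ℝ)) (b := fun a => (U a : ℝ))).inter_left hcl
  obtain ⟨y, hyF, hyext⟩ := hcomp.extremePoints_nonempty ⟨x, hx, hxL, hxU⟩
  -- An extreme point is integral: otherwise a circulation on its nonintegral arrows, which lie
  -- strictly between their integral capacities, moves it both ways inside `F`.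
  have hint : ∀ a, ∃ n : ℤ, y a = n := by
    by_contra! hcon
    obtain ⟨a₀, ha₀⟩ := hcon
    set E : Finset A := Finset.univ.filter fun a => ∀ n : ℤ, y a ≠ n with hEdef
    have hE : ∀ a, a ∈ E ↔ ∀ n : ℤ, y a ≠ n := fun a => by simp [hEdef]
    obtain ⟨c, hc0, hcE, hc⟩ := exists_circulation s t E ⟨a₀, (hE a₀).2 ha₀⟩
      (endCount_ne_one_of_integral s t θ y hyF.1 E hE)
    have hev : ∀ᶠ ε : ℝ in nhdsWithin 0 (Set.Ioi 0), ∀ a,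
        ((L a : ℝ) ≤ y a + ε * c a ∧ y a + ε * c a ≤ U a) ∧
        ((L a : ℝ) ≤ y a - ε * c a ∧ y a - ε * c a ≤ U a) := by
      refine Filter.Eventually.filter_mono nhdsWithin_le_nhds (Filter.eventually_all.2 fun a => ?_)
      have hL := hyF.2.1 a
      have hU := hyF.2.2 a
      by_cases ha : a ∈ E
      · have hL' : (L a : ℝ) < y a := lt_of_le_of_ne hL fun h => (hE a).1 ha _ h.symm
        have hU' : y a < U a := lt_of_le_of_ne hU fun h => (hE a).1 ha _ h
        have hp : Filter.Tendsto (fun ε : ℝ => y a + ε * c a) (nhds 0) (nhds (y a)) := by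
          have : Continuous fun ε : ℝ => y a + ε * c a := by fun_prop
          simpa using this.tendsto 0
        have hm : Filter.Tendsto (fun ε : ℝ => y a - ε * c a) (nhds 0) (nhds (y a)) := by
          have : Continuous fun ε : ℝ => y a - ε * c a := by fun_prop
          simpa using this.tendsto 0
        filter_upwards [hp.eventually (lt_mem_nhds hL'), hp.eventually (gt_mem_nhds hU'),
          hm.eventually (lt_mem_nhds hL'), hm.eventually (gt_mem_nhds hU')] with ε h1 h2 h3 h4
        exact ⟨⟨h1.le, h2.le⟩, h3.le, h4.le⟩
      · refine Filter.Eventually.of_forall fun ε => ?_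
        simpa [hcE a ha] using And.intro hL hU
    obtain ⟨ε, hε, hε0⟩ := (hev.and self_mem_nhdsWithin).exists
    have hsum : ∀ (r : ℝ) v, ∑ a, (y a + r * c a) * (incidence s t a v : ℝ) = θ v := by
      intro r v
      simp only [add_mul, Finset.sum_add_distrib, mul_assoc, ← Finset.mul_sum]
      rw [hyF.1, hc, mul_zero, add_zero]
    have h1 : (fun a => y a + ε * c a) ∈ F :=
      ⟨hsum ε, fun a => (hε a).1.1, fun a => (hε a).1.2⟩
    have h2 : (fun a => y a - ε * c a) ∈ F :=
      ⟨fun v => by simpa [sub_eq_add_neg] using hsum (-ε) v,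
        fun a => (hε a).2.1, fun a => (hε a).2.2⟩
    have h3 := hyext h1 h2 ⟨1 / 2, 1 / 2, by norm_num, by norm_num, by norm_num, by
      ext a
      simp
      ring⟩
    refine hc0 (funext fun a => ?_)
    have := congrFun h3 a
    have hε0' : (0 : ℝ) < ε := hε0
    simpa [hε0'.ne'] using this
  choose n hn using hint
  refine ⟨n, fun v => ?_, fun a => ?_⟩
  · have := hyF.1 v
    simp only [hn] at this
    exact_mod_cast this
  · have h1 := hyF.2.1 a
    have h2 := hyF.2.2 a
    simp only [hn] at h1 h2
    exact ⟨by exact_mod_cast h1, by exact_mod_cast h2⟩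

/-- Integer decomposition: an integral flow which is `k` times a feasible flow is a sum of `k`
feasible integral flows. -/
theorem exists_flow_decomposition [Fintype A] [Fintype V] (s t : A → V) (θ : V → ℤ) (L U : A → ℤ) (k : ℕ) (x : A → ℤ)
    (hx : ∀ v, ∑ a, x a * incidence s t a v = k * θ v)
    (hxL : ∀ a, k * L a ≤ x a) (hxU : ∀ a, x a ≤ k * U a) :
    ∃ y : Fin k → A → ℤ, (∀ i v, ∑ a, y i a * incidence s t a v = θ v) ∧
      (∀ i a, L a ≤ y i a ∧ y i a ≤ U a) ∧ ∀ a, ∑ i, y i a = x a := by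
  induction k generalizing x with
  | zero =>
    refine ⟨fun i => i.elim0, fun i => i.elim0, fun i => i.elim0, fun a => ?_⟩
    have h1 := hxL a
    have h2 := hxU a
    simp only [Nat.cast_zero, zero_mul] at h1 h2
    simpa using le_antisymm h1 h2
  | succ k ih =>
    have hk : (0 : ℝ) < (k : ℝ) + 1 := by positivity
    have hxL' : ∀ a, ((k : ℝ) + 1) * L a ≤ x a := fun a => by exact_mod_cast hxL a
    have hxU' : ∀ a, (x a : ℝ) ≤ ((k : ℝ) + 1) * U a := fun a => by exact_mod_cast hxU a
    have hd : ∀ a, ((k : ℝ) + 1) * ((x a : ℝ) / ((k : ℝ) + 1)) = x a := fun a => by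
      field_simp
    have hqL : ∀ a, (L a : ℝ) ≤ x a / ((k : ℝ) + 1) := fun a => by
      rw [le_div_iff₀ hk]
      linarith [hxL' a]
    have hqU : ∀ a, (x a : ℝ) / ((k : ℝ) + 1) ≤ U a := fun a => by
      rw [div_le_iff₀ hk]
      linarith [hxU' a]
    -- The extra bounds on the first summand `y` say exactly that `x - y` is feasible for `k`
    -- summands; the average `x / (k + 1)` meets them.
    obtain ⟨y, hy, hyb⟩ := exists_integral_flow s t θ
      (fun a => max (L a) (x a - k * U a)) (fun a => min (U a) (x a - k * L a))
      (fun a => (x a : ℝ) / ((k : ℝ) + 1)) (fun v => by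
        have : (∑ a, (x a : ℝ) * (incidence s t a v : ℝ)) = ((k : ℝ) + 1) * θ v := by
          exact_mod_cast hx v
        simp only [div_mul_eq_mul_div, ← Finset.sum_div]
        rw [this]
        field_simp)
      (fun a => by
        push_cast
        refine max_le (hqL a) ?_
        have := mul_le_mul_of_nonneg_left (hqU a) (Nat.cast_nonneg (α := ℝ) k)
        linarith [hd a])
      (fun a => by
        push_cast
        refine le_min (hqU a) ?_
        have := mul_le_mul_of_nonneg_left (hqL a) (Nat.cast_nonneg (α := ℝ) k)
        linarith [hd a])
    obtain ⟨z, hz, hzb, hzs⟩ := ih (fun a => x a - y a)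
      (fun v => by
        have := hx v
        push_cast at this
        simp only [sub_mul, Finset.sum_sub_distrib]
        rw [this, hy]
        ring)
      (fun a => by
        have := (hyb a).2.trans (min_le_right _ _)
        linarith)
      (fun a => by
        have := (le_max_right _ _).trans (hyb a).1
        linarith)
    refine ⟨Fin.cons y z, ?_, ?_, fun a => ?_⟩
    · intro i
      refine Fin.cases ?_ (fun j => ?_) i
      · simpa using hy
      · simpa using hz j
    · intro i
      refine Fin.cases (fun a => ?_) (fun j => ?_) i
      · exact ⟨(le_max_left _ _).trans (hyb a).1, (hyb a).2.trans (min_le_left _ _)⟩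
      · simpa using hzb j
    · rw [Fin.sum_univ_succ]
      simp [hzs]

end Flow

/-- Labels which are separated from the others, up to a common label `p`, by coordinates form
together with `p` an affinely independent family. -/
theorem affineIndependent_insert_of_separated {σ A : Type*} [DecidableEq σ]
    {G : σ → A → ℤ} {F : Finset σ} {p : σ} (hpF : p ∉ F)
    (hF : 2 ≤ F.card)
    (hsep : ∀ w ∈ F, ∃ (a : A) (o : ℤ), G p a ≠ o ∧ G w a = G p a ∧
      ∀ z ∈ F, z ≠ w → G z a = o) :
    AffineIndependent ℝ fun z : (insert p F : Finset σ) => intToReal (G z) := by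
  rw [affineIndependent_iff_of_fintype]
  intro w hw0 hw
  rw [Finset.weightedVSub_eq_linear_combination _ hw0] at hw
  set w' : σ → ℝ := fun z => if h : z ∈ insert p F then w ⟨z, h⟩ else 0 with hw'
  have hww : ∀ i : (insert p F : Finset σ), w i = w' i := fun i => by simp only [hw']; rw [dif_pos i.2]
  have h0 : w' p + ∑ z ∈ F, w' z = 0 := by
    rw [← Finset.sum_insert hpF, ← Finset.sum_coe_sort, ← hw0]
    exact Finset.sum_congr rfl fun i _ => (hww i).symm
  have h1 : ∀ a, w' p * G p a + ∑ z ∈ F, w' z * G z a = 0 := by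
    intro a
    rw [← Finset.sum_insert (f := fun z => w' z * (G z a : ℝ)) hpF, ← Finset.sum_coe_sort]
    have := congrFun hw a
    simpa [Finset.sum_apply, hww, intToReal] using this
  have h2 : ∀ z ∈ F, w' z = - w' p := by
    intro y hy
    obtain ⟨a, o, ho, hya, hz⟩ := hsep y hy
    -- Since the weights sum to zero, the coordinate may be shifted by `o`, leaving only the terms
    -- of `p` and `y`, with equal factors.
    have h3 : w' p * (G p a - o) + ∑ z ∈ F, w' z * (G z a - o) = 0 := by
      simp only [mul_sub, Finset.sum_sub_distrib, ← Finset.sum_mul]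
      linear_combination h1 a - (o : ℝ) * h0
    rw [Finset.sum_eq_single_of_mem y hy fun z hzF hne => by rw [hz z hzF hne]; simp, hya,
      ← add_mul] at h3
    have ho' : (G p a : ℝ) - o ≠ 0 := sub_ne_zero.2 (by exact_mod_cast ho)
    linarith [(mul_eq_zero.1 h3).resolve_right ho']
  have hp0 : w' p = 0 := by
    rw [Finset.sum_congr rfl h2, Finset.sum_const, nsmul_eq_mul] at h0
    have hF' : (2 : ℝ) ≤ F.card := by exact_mod_cast hF
    have h3 : w' p * (1 - F.card) = 0 := by linear_combination h0
    exact (mul_eq_zero.1 h3).resolve_right (by linarith)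
  intro i
  rw [hww]
  rcases Finset.mem_insert.1 i.2 with h | h
  · rw [h, hp0]
  · rw [h2 _ h, hp0, neg_zero]

/-! ### Unit cells and nonstandard products -/

section Core

set_option linter.unusedSectionVars false

variable {σ : Type uι} [Fintype σ] {A : Type*}

/-- The monomials `t^α` and `t^β` have the same degree and the same sum of labels. -/
def SameClass (G : σ → A → ℤ) (α β : σ →₀ ℕ) : Prop :=
  (∀ a, ∑ z, (α z : ℤ) * G z a = ∑ z, (β z : ℤ) * G z a) ∧ ∑ z, α z = ∑ z, β z

/-- The convex weight `∑ z(a)²` of a label. -/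
def sqWeight [Fintype A] (G : σ → A → ℤ) (z : σ) : ℕ := ∑ a, (G z a).natAbs ^ 2

/-- The weighted reverse lexicographic order for the weight `sqWeight`. -/
noncomputable def flowOrder [LinearOrder σ] [Fintype A] (G : σ → A → ℤ) :
    MonomialOrder.{uι, uι} σ :=
  weightedRevLex (sqWeight G)

/-- The monomials which are not minimal in their class. -/
def Nonstandard [LinearOrder σ] [Fintype A] (G : σ → A → ℤ) (α : σ →₀ ℕ) : Prop :=
  ∃ β, SameClass G β α ∧ (flowOrder G).toSyn β < (flowOrder G).toSyn α

/-- The weight of a monomial, normalized to vanish on the cell `c ≤ x ≤ c + 1`. -/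
def excess [Fintype A] (G : σ → A → ℤ) (c : A → ℤ) (α : σ →₀ ℕ) : ℤ :=
  ∑ z, (α z : ℤ) * ∑ a, (G z a - c a) * (G z a - c a - 1)

theorem mul_sub_one_nonneg (x : ℤ) : 0 ≤ x * (x - 1) := by
  rcases le_or_gt x 0 with h | h
  · exact mul_nonneg_of_nonpos_of_nonpos h (by omega)
  · exact mul_nonneg h.le (by omega)

theorem excess_nonneg [Fintype A] (G : σ → A → ℤ) (c : A → ℤ) (α : σ →₀ ℕ) :
    0 ≤ excess G c α :=
  Finset.sum_nonneg fun _ _ => mul_nonneg (Int.natCast_nonneg _)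
    (Finset.sum_nonneg fun _ _ => mul_sub_one_nonneg _)

theorem excess_eq_zero_iff [Fintype A] (G : σ → A → ℤ) (c : A → ℤ) (α : σ →₀ ℕ) :
    excess G c α = 0 ↔ ∀ z ∈ α.support, ∀ a, c a ≤ G z a ∧ G z a ≤ c a + 1 := by
  have key : ∀ x : ℤ, x * (x - 1) = 0 ↔ 0 ≤ x ∧ x ≤ 1 := by
    intro x
    rw [mul_eq_zero]
    omega
  rw [excess, Finset.sum_eq_zero_iff_of_nonneg fun _ _ => mul_nonneg (Int.natCast_nonneg _)
    (Finset.sum_nonneg fun _ _ => mul_sub_one_nonneg _)]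
  refine forall_congr' fun z => ?_
  rw [mul_eq_zero, Finset.sum_eq_zero_iff_of_nonneg fun _ _ => mul_sub_one_nonneg _]
  simp only [Finset.mem_univ, true_imp_iff, Finsupp.mem_support_iff, key, Int.natCast_eq_zero]
  rw [or_iff_not_imp_left]
  refine imp_congr_right fun _ => forall_congr' fun a => ?_
  constructor <;> rintro ⟨h1, h2⟩ <;> constructor <;> linarith

/-- The polynomial `(x - c)(x - c - 1)` is `x²` plus an affine function of `x`, and affine functions
of the labels sum to the same value throughout a class. -/
theorem excess_sub_excess [Fintype A] (G : σ → A → ℤ) (c : A → ℤ) {α β : σ →₀ ℕ}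
    (h : SameClass G β α) :
    (Finsupp.linearCombination ℕ (fun z => sqWeight G z + 1) β : ℤ) -
      (Finsupp.linearCombination ℕ (fun z => sqWeight G z + 1) α : ℕ) =
      excess G c β - excess G c α := by
  have hf : ∀ γ : σ →₀ ℕ, excess G c γ =
      (Finsupp.linearCombination ℕ (fun z => sqWeight G z + 1) γ : ℕ)
        - ∑ a, (2 * c a + 1) * ∑ z, (γ z : ℤ) * G z a
        + (∑ a, c a * (c a + 1) - 1) * (∑ z, γ z : ℕ) := by
    intro γ
    have hz : ∀ z, ∑ a, (G z a - c a) * (G z a - c a - 1) = ((sqWeight G z + 1 : ℕ) : ℤ)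
        - ∑ a, (2 * c a + 1) * G z a + (∑ a, c a * (c a + 1) - 1) := by
      intro z
      have : ∑ a, (G z a - c a) * (G z a - c a - 1) =
          ∑ a, (G z a ^ 2 - (2 * c a + 1) * G z a + c a * (c a + 1)) :=
        Finset.sum_congr rfl fun a _ => by ring
      rw [this, Finset.sum_add_distrib, Finset.sum_sub_distrib, sqWeight]
      push_cast
      simp only [sq_abs]
      ring
    have hc : ∑ a, (2 * c a + 1) * ∑ z, (γ z : ℤ) * G z a =
        ∑ z, (γ z : ℤ) * ∑ a, (2 * c a + 1) * G z a := by
      simp only [Finset.mul_sum]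
      rw [Finset.sum_comm]
      exact Finset.sum_congr rfl fun z _ => Finset.sum_congr rfl fun a _ => mul_left_comm _ _ _
    rw [Finsupp.linearCombination_apply, Finsupp.sum_fintype _ _ (by simp), hc, excess]
    rw [Finset.sum_congr rfl fun z _ => congrArg _ (hz z)]
    simp only [mul_add (_ : ℤ) (_ - _), mul_sub _ ((_ : ℕ) : ℤ), Finset.sum_add_distrib,
      Finset.sum_sub_distrib, ← Finset.sum_mul, smul_eq_mul]
    push_cast
    ring
  rw [hf, hf, h.2]
  simp only [h.1]
  ring

theorem sum_single_mul (z : σ) (f : σ → ℤ) :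
    ∑ y, ((Finsupp.single z 1 : σ →₀ ℕ) y : ℤ) * f y = f z := by
  classical
  simp [Finsupp.single_apply]

theorem sum_single_one (z : σ) : ∑ y, (Finsupp.single z 1 : σ →₀ ℕ) y = 1 := by
  classical
  simp [Finsupp.single_apply]

/-- The square-free monomial `∏ z ∈ F, t_z`. -/
noncomputable def squarefreeMonomial (F : Finset σ) : σ →₀ ℕ := ∑ z ∈ F, Finsupp.single z 1

theorem squarefreeMonomial_apply [DecidableEq σ] (F : Finset σ) (z : σ) :
    squarefreeMonomial F z = if z ∈ F then 1 else 0 := by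
  simp [squarefreeMonomial, Finsupp.finsetSum_apply, Finsupp.single_apply]

theorem mem_support_squarefreeMonomial (F : Finset σ) (z : σ) :
    z ∈ (squarefreeMonomial F).support ↔ z ∈ F := by
  classical
  simp [squarefreeMonomial_apply]

theorem sum_squarefreeMonomial_mul (F : Finset σ) (f : σ → ℤ) :
    ∑ z, (squarefreeMonomial F z : ℤ) * f z = ∑ z ∈ F, f z := by
  classical
  simp [squarefreeMonomial_apply]

theorem sum_squarefreeMonomial (F : Finset σ) : ∑ z, squarefreeMonomial F z = F.card := by
  classical
  simp [squarefreeMonomial_apply]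

variable [Fintype A] {V : Type*} [Fintype V] [DecidableEq V]

/-- `G` enumerates the integral flows between the capacities `l` and `u`. -/
structure IsFlowEnumeration (s t : A → V) (θ : V → ℤ) (l u : A → ℤ) (G : σ → A → ℤ) : Prop where
  injective : Function.Injective G
  mem_range_iff : ∀ y, y ∈ Set.range G ↔
    (∀ v, ∑ a, y a * incidence s t a v = θ v) ∧ ∀ a, l a ≤ y a ∧ y a ≤ u a

variable {s t : A → V} {θ : V → ℤ} {l u : A → ℤ} {G : σ → A → ℤ}

theorem IsFlowEnumeration.flow (hG : IsFlowEnumeration s t θ l u G) (z : σ) (v : V) :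
    ∑ a, G z a * incidence s t a v = θ v :=
  ((hG.mem_range_iff _).1 ⟨z, rfl⟩).1 v

theorem IsFlowEnumeration.bounds (hG : IsFlowEnumeration s t θ l u G) (z : σ) (a : A) :
    l a ≤ G z a ∧ G z a ≤ u a :=
  ((hG.mem_range_iff _).1 ⟨z, rfl⟩).2 a

/-- Integer decomposition for the capacities intersected with the cell `c ≤ x ≤ c + 1`: it yields
representatives of least weight. -/
theorem IsFlowEnumeration.exists_decomposition (hG : IsFlowEnumeration s t θ l u G) (k : ℕ)
    (x c : A → ℤ) (hx : ∀ v, ∑ a, x a * incidence s t a v = k * θ v)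
    (hl : ∀ a, k * l a ≤ x a) (hu : ∀ a, x a ≤ k * u a)
    (hc : ∀ a, k * c a ≤ x a) (hc' : ∀ a, x a ≤ k * (c a + 1)) :
    ∃ β : σ →₀ ℕ, ∑ z, β z = k ∧ (∀ a, ∑ z, (β z : ℤ) * G z a = x a) ∧ excess G c β = 0 := by
  classical
  have hk : (0 : ℤ) ≤ k := Int.natCast_nonneg k
  obtain ⟨y, hy, hyb, hys⟩ := exists_flow_decomposition s t θ (fun a => max (l a) (c a))
    (fun a => min (u a) (c a + 1)) k x hx
    (fun a => by rw [mul_max_of_nonneg _ _ hk]; exact max_le (hl a) (hc a))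
    (fun a => by rw [mul_min_of_nonneg _ _ hk]; exact le_min (hu a) (hc' a))
  have : ∀ i, ∃ z, G z = y i := fun i => (hG.mem_range_iff _).2
    ⟨hy i, fun a => ⟨(le_max_left _ _).trans (hyb i a).1, (hyb i a).2.trans (min_le_left _ _)⟩⟩
  choose g hg using this
  have hsum : ∀ f : σ → ℤ, ∑ z, ((∑ i, Finsupp.single (g i) 1 : σ →₀ ℕ) z : ℤ) * f z =
      ∑ i, f (g i) := by
    intro f
    simp only [Finsupp.finsetSum_apply, Nat.cast_sum, Finset.sum_mul]
    rw [Finset.sum_comm]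
    exact Finset.sum_congr rfl fun i _ => sum_single_mul _ _
  refine ⟨∑ i, Finsupp.single (g i) 1, ?_, fun a => ?_, ?_⟩
  · have := hsum fun _ => 1
    simp only [mul_one, Finset.sum_const, Finset.card_univ, Fintype.card_fin, nsmul_one] at this
    exact_mod_cast this
  · rw [hsum fun z => G z a, ← hys]
    simp only [hg]
  · rw [excess, hsum fun z => ∑ a, (G z a - c a) * (G z a - c a - 1)]
    refine Finset.sum_eq_zero fun i _ => Finset.sum_eq_zero fun a _ => ?_
    rw [hg]
    have h1 := (le_max_right _ _).trans (hyb i a).1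
    have h2 := (hyb i a).2.trans (min_le_right _ _)
    rw [mul_eq_zero]
    omega

theorem nonstandard_of_excess_lt [LinearOrder σ] (c : A → ℤ) {α β : σ →₀ ℕ}
    (h : SameClass G β α) (hlt : excess G c β < excess G c α) : Nonstandard G α := by
  refine ⟨β, h, (weightedRevLex_lt_iff _).2 (Or.inl ?_)⟩
  have := excess_sub_excess G c h
  omega

/-- Two labels which are not in a common unit cell have a nonstandard product. -/
theorem IsFlowEnumeration.nonstandard_pair [LinearOrder σ] (hG : IsFlowEnumeration s t θ l u G)
    {z z' : σ} {a : A} (h : G z a + 2 ≤ G z' a) :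
    Nonstandard G (Finsupp.single z 1 + Finsupp.single z' 1) := by
  have hsum : ∀ f : σ → ℤ,
      ∑ y, ((Finsupp.single z 1 + Finsupp.single z' 1 : σ →₀ ℕ) y : ℤ) * f y = f z + f z' := by
    intro f
    simp only [Finsupp.add_apply, Nat.cast_add, add_mul, Finset.sum_add_distrib, sum_single_mul]
  -- The rounded-down midpoint is the corner of a cell containing the midpoint; `z` and `z'` cannot
  -- both lie in it.
  obtain ⟨β, hβ, hβG, hβe⟩ := hG.exists_decomposition 2 (fun b => G z b + G z' b)
    (fun b => (G z b + G z' b) / 2)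
    (fun v => by
      simp only [add_mul, Finset.sum_add_distrib, hG.flow]
      push_cast
      ring)
    (fun b => by have := hG.bounds z b; have := hG.bounds z' b; push_cast; omega)
    (fun b => by have := hG.bounds z b; have := hG.bounds z' b; push_cast; omega)
    (fun b => by push_cast; omega) (fun b => by push_cast; omega)
  refine nonstandard_of_excess_lt (fun b => (G z b + G z' b) / 2) (β := β)
    ⟨fun b => by rw [hβG, hsum fun y => G y b], ?_⟩ ?_
  · simp [hβ, Finset.sum_add_distrib]
  · rw [hβe]
    refine lt_of_le_of_ne (excess_nonneg _ _ _) fun h0 => ?_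
    have h1 := (excess_eq_zero_iff _ _ _).1 h0.symm
    have hz := h1 z (by simp) a
    have hz' := h1 z' (by simp) a
    omega

/-- If a label `p` in a unit cell is below the labels in `F` in the same cell, and agrees in each
coordinate with one of them, then the product of `F` is nonstandard. -/
theorem IsFlowEnumeration.nonstandard_squarefreeMonomial [LinearOrder σ]
    (hG : IsFlowEnumeration s t θ l u G) {F : Finset σ} (hne : F.Nonempty) {p : σ} {c : A → ℤ}
    (hF : ∀ z ∈ F, ∀ a, c a ≤ G z a ∧ G z a ≤ c a + 1)
    (hpc : ∀ a, c a ≤ G p a ∧ G p a ≤ c a + 1)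
    (hlt : ∀ z ∈ F, p < z) (hp : ∀ a, ∃ z ∈ F, G z a = G p a) :
    Nonstandard G (squarefreeMonomial F) := by
  classical
  have hcard : ((F.card - 1 : ℕ) : ℤ) = (F.card : ℤ) - 1 := by
    have := Finset.card_pos.2 hne
    omega
  -- In a single coordinate, subtracting `p` is the same as deleting a member of `F` that agrees
  -- with it, which leaves `|F| - 1` labels to bound.
  have hb : ∀ a (m M : ℤ), (∀ z ∈ F, m ≤ G z a ∧ G z a ≤ M) →
      ((F.card - 1 : ℕ) : ℤ) * m ≤ ∑ z ∈ F, G z a - G p a ∧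
      ∑ z ∈ F, G z a - G p a ≤ ((F.card - 1 : ℕ) : ℤ) * M := by
    intro a m M h
    obtain ⟨z, hz, hza⟩ := hp a
    rw [← hza, ← Finset.sum_erase_eq_sub hz, ← Finset.card_erase_of_mem hz]
    rw [← nsmul_eq_mul, ← nsmul_eq_mul]
    exact ⟨Finset.card_nsmul_le_sum _ _ _ fun y hy => (h y (Finset.mem_of_mem_erase hy)).1,
      Finset.sum_le_card_nsmul _ _ _ fun y hy => (h y (Finset.mem_of_mem_erase hy)).2⟩
  obtain ⟨β, hβ, hβG, hβe⟩ := hG.exists_decomposition (F.card - 1)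
    (fun a => ∑ z ∈ F, G z a - G p a) c
    (fun v => by
      simp only [sub_mul, Finset.sum_sub_distrib, Finset.sum_mul]
      rw [Finset.sum_comm]
      simp only [hG.flow, Finset.sum_const, hcard]
      rw [nsmul_eq_mul]
      ring)
    (fun a => (hb a _ _ fun z _ => hG.bounds z a).1)
    (fun a => (hb a _ _ fun z _ => hG.bounds z a).2)
    (fun a => (hb a _ _ fun z hz => hF z hz a).1)
    (fun a => (hb a _ _ fun z hz => hF z hz a).2)
  have hclass : SameClass G (β + Finsupp.single p 1) (squarefreeMonomial F) := by
    refine ⟨fun a => ?_, ?_⟩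
    · simp only [Finsupp.add_apply, Nat.cast_add, add_mul, Finset.sum_add_distrib]
      rw [sum_single_mul p fun z => G z a, sum_squarefreeMonomial_mul F fun z => G z a, hβG]
      ring
    · simp only [Finsupp.add_apply, Finset.sum_add_distrib]
      rw [sum_single_one, sum_squarefreeMonomial, hβ]
      have := Finset.card_pos.2 hne
      omega
  have he1 : excess G c (β + Finsupp.single p 1) = 0 := by
    rw [excess_eq_zero_iff] at hβe ⊢
    intro z hz
    rcases Finset.mem_union.1 (Finsupp.support_add hz) with h | h
    · exact hβe z h
    · rw [Finset.mem_singleton.1 (Finsupp.support_single_subset h)]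
      exact hpc
  have he2 : excess G c (squarefreeMonomial F) = 0 := by
    rw [excess_eq_zero_iff]
    exact fun z hz => hF z ((mem_support_squarefreeMonomial F z).1 hz)
  refine ⟨_, hclass, weightedRevLex_lt_of_mem _ ?_ (p := p) (by simp)
    fun z hz => hlt z ((mem_support_squarefreeMonomial F z).1 hz)⟩
  have := excess_sub_excess G c hclass
  omega

end Core

/-! ### Minimal nonstandard monomials -/

section Minimal

set_option linter.unusedSectionVars false

variable {σ : Type uι} [Fintype σ] [LinearOrder σ] {A : Type*} [Fintype A]

theorem intToReal_injective {ι : Type*} : Function.Injective (intToReal (ι := ι)) := by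
  intro x y h
  ext i
  exact Int.cast_injective (α := ℝ) (congrFun h i)

theorem SameClass.of_add {G : σ → A → ℤ} {α β γ : σ →₀ ℕ} (h : SameClass G (β + γ) (α + γ)) :
    SameClass G β α := by
  refine ⟨fun a => ?_, ?_⟩
  · have := h.1 a
    simpa only [Finsupp.add_apply, Nat.cast_add, add_mul, Finset.sum_add_distrib,
      add_left_inj] using this
  · have := h.2
    simpa only [Finsupp.add_apply, Finset.sum_add_distrib, add_left_inj] using this

/-- A minimal nonstandard monomial has no variable in common with a smaller one of its class. -/
theorem disjoint_support_of_minimal {G : σ → A → ℤ} {α β : σ →₀ ℕ}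
    (hα : Minimal (Nonstandard G) α) (hc : SameClass G β α)
    (hlt : (flowOrder G).toSyn β < (flowOrder G).toSyn α) {z : σ} (hzα : z ∈ α.support) :
    z ∉ β.support := by
  intro hzβ
  have h1 : ∀ γ : σ →₀ ℕ, z ∈ γ.support → γ - Finsupp.single z 1 + Finsupp.single z 1 = γ := by
    intro γ hγ
    refine tsub_add_cancel_of_le ?_
    rw [Finsupp.single_le_iff]
    exact Nat.one_le_iff_ne_zero.2 (Finsupp.mem_support_iff.1 hγ)
  -- A common variable cancels, giving a proper nonstandard divisor.
  have hns : Nonstandard G (α - Finsupp.single z 1) := by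
    refine ⟨β - Finsupp.single z 1, SameClass.of_add (γ := Finsupp.single z 1) ?_, ?_⟩
    · rwa [h1 α hzα, h1 β hzβ]
    · rw [← h1 α hzα, ← h1 β hzβ, map_add, map_add] at hlt
      exact lt_of_add_lt_add_right hlt
  have h2 := hα.2 hns tsub_le_self z
  have h3 : α z ≠ 0 := Finsupp.mem_support_iff.1 hzα
  simp only [Finsupp.tsub_apply, Finsupp.single_eq_same] at h2
  omega

theorem squarefreeMonomial_le {α : σ →₀ ℕ} {F : Finset σ} (h : F ⊆ α.support) :
    squarefreeMonomial F ≤ α := by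
  intro z
  rw [squarefreeMonomial_apply]
  split_ifs with hz
  · exact Nat.one_le_iff_ne_zero.2 (Finsupp.mem_support_iff.1 (h hz))
  · exact Nat.zero_le _

variable {V : Type*} [Fintype V] [DecidableEq V]
  {s t : A → V} {θ : V → ℤ} {l u : A → ℤ} {G : σ → A → ℤ}

/-- The labels of a minimal nonstandard monomial lie in a common unit cell, together with a label
below all of them which agrees with one of them in each coordinate. -/
theorem exists_below_of_minimal {α : σ →₀ ℕ} (hα : Minimal (Nonstandard G) α)
    (hcell : ∀ z ∈ α.support, ∀ z' ∈ α.support, ∀ a, G z' a < G z a + 2) :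
    ∃ (c : A → ℤ) (p : σ), (∀ z ∈ α.support, ∀ a, c a ≤ G z a ∧ G z a ≤ c a + 1) ∧
      (∀ a, c a ≤ G p a ∧ G p a ≤ c a + 1) ∧ (∀ z ∈ α.support, p < z) ∧
      ∀ a, ∃ z ∈ α.support, G z a = G p a := by
  obtain ⟨β, hc, hlt⟩ := hα.1
  have hne : α.support.Nonempty := by
    rw [Finsupp.support_nonempty_iff]
    rintro rfl
    rw [map_zero] at hlt
    exact absurd ((flowOrder G).zero_le _) (not_le.2 hlt)
  have hmin : ∀ a, ∃ z ∈ α.support, ∀ z' ∈ α.support, G z a ≤ G z' a :=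
    fun a => Finset.exists_min_image α.support (fun z => G z a) hne
  choose g hg hgmin using hmin
  set c : A → ℤ := fun a => G (g a) a with hcdef
  have hαc : ∀ z ∈ α.support, ∀ a, c a ≤ G z a ∧ G z a ≤ c a + 1 := fun z hz a =>
    ⟨hgmin a z hz, by have := hcell _ (hg a) z hz a; simp only [hcdef]; omega⟩
  have hα0 := (excess_eq_zero_iff G c α).2 hαc
  have hβ := excess_nonneg G c β
  have hsub := excess_sub_excess G c hc
  have hlt' := (weightedRevLex_lt_iff _).1 hlt
  -- The excess of `α` is zero and that of `β` nonnegative, so the weights tie and `β` lies in the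
  -- cell too. Exponents agree below `p`, so disjointness of supports puts `p` below `α`.
  rcases hlt' with h | ⟨h, p, hpq, hp⟩
  · omega
  have hβc := (excess_eq_zero_iff G c β).1 (by omega)
  have hpβ : p ∈ β.support := Finsupp.mem_support_iff.2 (by omega)
  refine ⟨c, p, hαc, hβc p hpβ, fun z hz => ?_, fun a => ?_⟩
  · by_contra hzp
    rcases lt_or_eq_of_le (not_lt.1 hzp) with h | rfl
    · refine disjoint_support_of_minimal hα hc hlt hz (Finsupp.mem_support_iff.2 ?_)
      rw [← hpq z h]
      exact Finsupp.mem_support_iff.1 hz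
    · exact disjoint_support_of_minimal hα hc hlt hz hpβ
  · by_contra! hcon
    have hshift : ∀ e : ℤ, ∑ z, (β z : ℤ) * (G z a - e) = ∑ z, (α z : ℤ) * (G z a - e) := by
      intro e
      have h2 : (∑ z, (β z : ℤ)) = ∑ z, (α z : ℤ) := by exact_mod_cast hc.2
      simp only [mul_sub, Finset.sum_sub_distrib, ← Finset.sum_mul, hc.1 a, h2]
    have hpos : (0 : ℤ) < β p := by
      have := Finsupp.mem_support_iff.1 hpβ
      omega
    have hpa := hβc p hpβ a
    have hzero : ∀ e : ℤ, (∀ z ∈ α.support, G z a = e) →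
        ∑ z, (α z : ℤ) * (G z a - e) = 0 := by
      intro e he
      refine Finset.sum_eq_zero fun z _ => ?_
      by_cases hz : z ∈ α.support
      · rw [he z hz, sub_self, mul_zero]
      · rw [Finsupp.notMem_support_iff.1 hz, Nat.cast_zero, zero_mul]
    -- If no label of `α` agrees with `p` at `a`, all take the other end value `e` of the cell. The
    -- labels of `β` lie on one side of `e` (the sign `ε`) with the same average, so they all equal
    -- `e`, including `p`.
    have hterm : ∀ (e ε : ℤ), (∀ z ∈ α.support, G z a = e) →
        (∀ z ∈ β.support, 0 ≤ ε * (G z a - e)) → ε * (G p a - e) ≤ 0 := by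
      intro e ε he hb
      have h1 : ∑ z, (β z : ℤ) * (ε * (G z a - e)) = 0 := by
        have := (hshift e).trans (hzero e he)
        calc ∑ z, (β z : ℤ) * (ε * (G z a - e)) = ε * ∑ z, (β z : ℤ) * (G z a - e) := by
              rw [Finset.mul_sum]
              exact Finset.sum_congr rfl fun z _ => mul_left_comm _ _ _
          _ = 0 := by rw [this, mul_zero]
      have hnn : ∀ z ∈ Finset.univ, 0 ≤ (β z : ℤ) * (ε * (G z a - e)) := by
        intro z _
        by_cases hz : z ∈ β.support
        · exact mul_nonneg (Int.natCast_nonneg _) (hb z hz)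
        · rw [Finsupp.notMem_support_iff.1 hz, Nat.cast_zero, zero_mul]
      have h2 := (Finset.sum_eq_zero_iff_of_nonneg hnn).1 h1 p (Finset.mem_univ _)
      exact ((mul_eq_zero.1 h2).resolve_left hpos.ne').le
    rcases (show G p a = c a ∨ G p a = c a + 1 by omega) with h0 | h0
    · have := hterm (c a + 1) (-1)
        (fun z hz => by have := hαc z hz a; have := hcon z hz; omega)
        (fun z hz => by have := hβc z hz a; omega)
      omega
    · have := hterm (c a) 1
        (fun z hz => by have := hαc z hz a; have := hcon z hz; omega)
        (fun z hz => by have := hβc z hz a; omega)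
      omega

/-- Each nonstandard monomial has a square-free nonstandard divisor of small degree. -/
theorem IsFlowEnumeration.exists_squarefree_divisor (hG : IsFlowEnumeration s t θ l u G) (d : ℕ)
    (hd : ∀ (n : ℕ) (f : Fin n → σ), AffineIndependent ℝ (fun i => intToReal (G (f i))) →
      n ≤ d + 1) {α : σ →₀ ℕ} (hα : Nonstandard G α) :
    ∃ γ ≤ α, Nonstandard G γ ∧ (∀ z, γ z ≤ 1) ∧ ∑ z, γ z ≤ if d = 1 then 2 else d := by
  obtain ⟨γ, hle, hγ⟩ := exists_minimal_le_of_wellFoundedLT (Nonstandard G) α hα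
  refine ⟨γ, hle, hγ.1, ?_⟩
  by_cases hpair : ∃ z ∈ γ.support, ∃ z' ∈ γ.support, ∃ a, G z a + 2 ≤ G z' a
  · obtain ⟨z, hz, z', hz', a, ha⟩ := hpair
    have hne : z ≠ z' := by
      rintro rfl
      omega
    have hs : Finsupp.single z 1 + Finsupp.single z' 1 = squarefreeMonomial {z, z'} := by
      rw [squarefreeMonomial, Finset.sum_pair hne]
    have hle' : squarefreeMonomial {z, z'} ≤ γ := squarefreeMonomial_le (by
      intro y hy
      rcases Finset.mem_insert.1 hy with rfl | hy
      · exact hz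
      · rwa [Finset.mem_singleton.1 hy])
    have hγs : γ = squarefreeMonomial {z, z'} :=
      le_antisymm (hγ.2 (hs ▸ hG.nonstandard_pair ha) hle') hle'
    refine ⟨fun y => ?_, ?_⟩
    · rw [hγs, squarefreeMonomial_apply]
      split_ifs <;> omega
    · rw [hγs, sum_squarefreeMonomial, Finset.card_pair hne]
      -- Two distinct labels force `d ≥ 1`; only for `d = 1` does degree 2 exceed `d`.
      have h2 := hd 2 ![z, z'] (by
        have := affineIndependent_of_ne ℝ
          (fun h => hne (hG.injective (intToReal_injective h)) : intToReal (G z) ≠ intToReal (G z'))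
        have hf : (fun i => intToReal (G (![z, z'] i))) = ![intToReal (G z), intToReal (G z')] := by
          funext i
          fin_cases i <;> rfl
        rwa [hf])
      split_ifs <;> omega
  · push Not at hpair
    obtain ⟨c, p, hγc, hpc, hlt, hp⟩ := exists_below_of_minimal hγ hpair
    have hpF : p ∉ γ.support := fun h => lt_irrefl _ (hlt p h)
    have hne : γ.support.Nonempty := by
      by_contra h
      have h0 : γ = 0 := by simpa using h
      obtain ⟨β, -, hb⟩ := hγ.1
      rw [h0, map_zero] at hb
      exact absurd ((flowOrder G).zero_le _) (not_le.2 hb)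
    have hle' : squarefreeMonomial γ.support ≤ γ := squarefreeMonomial_le subset_rfl
    have hγs : γ = squarefreeMonomial γ.support :=
      le_antisymm (hγ.2 (hG.nonstandard_squarefreeMonomial hne hγc hpc hlt hp) hle') hle'
    -- A single label would agree with `p` in every coordinate, hence equal `p`.
    have hcard : 2 ≤ γ.support.card := by
      by_contra hlt2
      obtain ⟨z, hz⟩ := Finset.card_eq_one.1
        (by have := Finset.card_pos.2 hne; omega : γ.support.card = 1)
      have hGz : G z = G p := by
        funext a
        obtain ⟨y, hy, hya⟩ := hp a
        rw [hz, Finset.mem_singleton] at hy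
        rw [← hya, hy]
      exact hpF (by rw [hz, hG.injective hGz]; exact Finset.mem_singleton_self p)
    refine ⟨fun y => ?_, ?_⟩
    · rw [hγs, squarefreeMonomial_apply]
      split_ifs <;> omega
    -- Without `w` the product is standard, so in some coordinate only `w` agrees with `p`.
    have hsep : ∀ w ∈ γ.support, ∃ (a : A) (o : ℤ), G p a ≠ o ∧ G w a = G p a ∧
        ∀ z ∈ γ.support, z ≠ w → G z a = o := by
      intro w hw
      have hstd : ¬ Nonstandard G (squarefreeMonomial (γ.support.erase w)) := by
        intro h
        have h1 := hγ.2 h (squarefreeMonomial_le (Finset.erase_subset _ _)) w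
        rw [squarefreeMonomial_apply, if_neg (Finset.notMem_erase _ _)] at h1
        exact Finsupp.mem_support_iff.1 hw (Nat.le_zero.1 h1)
      have hne' : (γ.support.erase w).Nonempty := by
        rw [← Finset.card_pos, Finset.card_erase_of_mem hw]
        omega
      have h1 : ¬ ∀ a, ∃ z ∈ γ.support.erase w, G z a = G p a := fun h =>
        hstd (hG.nonstandard_squarefreeMonomial hne'
          (fun z hz => hγc z (Finset.mem_of_mem_erase hz)) hpc
          (fun z hz => hlt z (Finset.mem_of_mem_erase hz)) h)
      push Not at h1
      obtain ⟨a, ha⟩ := h1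
      -- The witness is the other of the two values `c a`, `c a + 1`.
      refine ⟨a, 2 * c a + 1 - G p a, by omega, ?_, fun z hz hzw => ?_⟩
      · obtain ⟨y, hy, hya⟩ := hp a
        by_cases hyw : y = w
        · rw [← hyw, hya]
        · exact absurd hya (ha y (Finset.mem_erase.2 ⟨hyw, hy⟩))
      · have h2 := ha z (Finset.mem_erase.2 ⟨hzw, hz⟩)
        have h3 := hγc z hz a
        have h4 := hpc a
        omega
    have hind := affineIndependent_insert_of_separated hpF hcard hsep
    have h2 := hd _ (fun i => ((insert p γ.support : Finset σ).equivFin.symm i : σ))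
      (hind.comp_embedding (insert p γ.support : Finset σ).equivFin.symm.toEmbedding)
    rw [Finset.card_insert_of_notMem hpF] at h2
    rw [hγs, sum_squarefreeMonomial]
    split_ifs <;> omega

end Minimal

/-! ### Transport along lattice equivalence -/

section Transport

theorem eq_zero_of_linear_eq_zero {ι κ : Type*} {P : Set (ι → ℝ)} {φ : (ι → ℝ) →ᵃ[ℝ] (κ → ℝ)}
    (hφ : Set.InjOn φ (affineSpan ℝ P : Set (ι → ℝ))) {v : ι → ℝ} (hv : v ∈ vectorSpan ℝ P)
    (h0 : φ.linear v = 0) : v = 0 := by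
  rcases P.eq_empty_or_nonempty with rfl | ⟨x, hx⟩
  · simpa using hv
  have hx' := mem_affineSpan ℝ hx
  have hvx : v +ᵥ x ∈ affineSpan ℝ P :=
    AffineSubspace.vadd_mem_of_mem_direction (by rwa [direction_affineSpan]) hx'
  have := hφ hvx hx' (by rw [AffineMap.map_vadd, h0, zero_vadd])
  simpa using this

/-- An affine map which is injective on the affine span of `P` preserves and reflects the affine
relations between points of `P`. -/
theorem sum_smul_eq_zero_iff {ι κ σ : Type*} [Fintype σ] {P : Set (ι → ℝ)}
    {φ : (ι → ℝ) →ᵃ[ℝ] (κ → ℝ)} (hφ : Set.InjOn φ (affineSpan ℝ P : Set (ι → ℝ)))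
    {p : σ → ι → ℝ} (hp : ∀ z, p z ∈ P) {w : σ → ℝ} (hw : ∑ z, w z = 0) :
    ∑ z, w z • p z = 0 ↔ ∑ z, w z • φ (p z) = 0 := by
  have h1 : ∑ z, w z • φ (p z) = φ.linear (∑ z, w z • p z) := by
    have h2 : ∀ x, φ x = φ.linear x + φ 0 := fun x => congrFun φ.decomp x
    rw [Finset.sum_congr rfl fun z _ => congrArg (w z • ·) (h2 (p z))]
    simp only [smul_add, Finset.sum_add_distrib, ← Finset.sum_smul, hw, zero_smul, add_zero,
      map_sum, map_smul]
  rw [h1]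
  refine ⟨fun h => by rw [h, map_zero], fun h => eq_zero_of_linear_eq_zero hφ ?_ h⟩
  rw [← Finset.weightedVSub_eq_linear_combination _ hw]
  exact vectorSpan_mono ℝ (Set.range_subset_iff.2 hp)
    (weightedVSub_mem_vectorSpan hw p)

theorem sameClass_iff_sum_sub_smul {ι σ : Type*} [Fintype σ] (g : σ → ι → ℤ) (α β : σ →₀ ℕ)
    (hdeg : ∑ z, α z = ∑ z, β z) :
    SameClass g α β ↔ ∑ z, ((α z : ℝ) - β z) • intToReal (g z) = 0 := by
  rw [SameClass, and_iff_left hdeg, funext_iff]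
  refine forall_congr' fun a => ?_
  rw [← sub_eq_zero, ← Int.cast_inj (α := ℝ)]
  simp [intToReal, Finset.sum_apply, sub_mul, Finset.sum_sub_distrib]

/-- Equivalence of monomials of equal degree is a linear relation whose weights `α - β` sum to zero.
Hence the toric ideal of `P` can be studied with flows as labels. -/
theorem sameClass_iff_of_affineMap {ι κ σ : Type*} [Fintype σ] {P : Set (ι → ℝ)}
    {φ : (ι → ℝ) →ᵃ[ℝ] (κ → ℝ)} (hφ : Set.InjOn φ (affineSpan ℝ P : Set (ι → ℝ)))
    {g : σ → ι → ℤ} {G : σ → κ → ℤ} (hg : ∀ z, intToReal (g z) ∈ P)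
    (hG : ∀ z, intToReal (G z) = φ (intToReal (g z))) (α β : σ →₀ ℕ) :
    SameClass g α β ↔ SameClass G α β := by
  by_cases hdeg : ∑ z, α z = ∑ z, β z
  · rw [sameClass_iff_sum_sub_smul g α β hdeg, sameClass_iff_sum_sub_smul G α β hdeg]
    simp only [hG]
    refine sum_smul_eq_zero_iff hφ hg ?_
    rw [Finset.sum_sub_distrib, sub_eq_zero]
    exact_mod_cast hdeg
  · exact iff_of_false (fun h => hdeg h.2) fun h => hdeg h.2

/-- The sum of the labels and the degree of a monomial. -/
noncomputable def classMap {ι σ : Type*} (g : σ → ι → ℤ) : (σ →₀ ℕ) →+ (ι → ℤ) × ℕ :=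
  (Finsupp.linearCombination ℕ g).toAddMonoidHom.prod
    (Finsupp.linearCombination ℕ fun _ => (1 : ℕ)).toAddMonoidHom

theorem classMap_apply {ι σ : Type*} (g : σ → ι → ℤ) (α : σ →₀ ℕ) :
    classMap g α = (α.sum fun z n => n • g z, α.sum fun _ n => n) := by
  simp [classMap, Finsupp.linearCombination_apply]

theorem classMap_eq_iff {ι σ : Type*} [Fintype σ] (g : σ → ι → ℤ) (α β : σ →₀ ℕ) :
    classMap g α = classMap g β ↔ SameClass g α β := by
  rw [classMap_apply, classMap_apply, Prod.mk.injEq, SameClass]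
  simp [Finsupp.sum_fintype, funext_iff, Finset.sum_apply]

theorem toricIdeal_eq_span (K : Type*) [Field K] {ι : Type*} (P : Set (ι → ℝ)) :
    toricIdeal K P = Ideal.span {f | ∃ α β : LatticePoint P →₀ ℕ,
      classMap (fun z : LatticePoint P => z.1) α = classMap (fun z : LatticePoint P => z.1) β ∧
      f = MvPolynomial.monomial α 1 - MvPolynomial.monomial β 1} := by
  simp only [toricIdeal, classMap_apply, Prod.mk.injEq, and_assoc]

theorem mem_flowSpace_iff {V : Type*} [Quiver V] [Fintype (Quiver.Total V)] [DecidableEq V]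
    (θ : V → ℤ) (x : Quiver.Total V → ℝ) :
    x ∈ flowSpace V θ ↔ ∀ v, ∑ a, x a *
      (incidence (fun a : Quiver.Total V => a.left) (fun a => a.right) a v : ℝ) = θ v := by
  refine forall_congr' fun v => ?_
  simp only [incidence, Int.cast_sub, Int.cast_ite, Int.cast_one, Int.cast_zero, mul_sub, mul_ite,
    mul_one, mul_zero, Finset.sum_sub_distrib, Finset.sum_filter]
  -- The two sides differ only in the decidability instances of the sums.
  convert Iff.rfl

theorem intToReal_mem_flowPolytope_iff {V : Type*} [Quiver V] [Fintype (Quiver.Total V)]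
    [DecidableEq V] (θ : V → ℤ) (l u : Quiver.Total V → ℕ) (y : Quiver.Total V → ℤ) :
    intToReal y ∈ flowPolytope V θ l u ↔
      (∀ v, ∑ a, y a * incidence (fun a : Quiver.Total V => a.left) (fun a => a.right) a v = θ v) ∧
      ∀ a, (l a : ℤ) ≤ y a ∧ y a ≤ (u a : ℤ) := by
  refine and_congr ((mem_flowSpace_iff θ _).trans (forall_congr' fun v => ?_))
    (forall_congr' fun a => ?_)
  · rw [← Int.cast_inj (α := ℝ)]
    push_cast
    rfl
  · rw [← Int.cast_le (R := ℝ), ← Int.cast_le (R := ℝ)]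
    rfl

/-- Lattice equivalence of `P` with a flow polytope enumerates the integral flows by the lattice
points of `P`. -/
theorem LatticeEquivalent.exists_labels {V : Type*} [Quiver V] [Fintype (Quiver.Total V)]
    [DecidableEq V] {θ : V → ℤ} {l u : Quiver.Total V → ℕ} {ι : Type*} {P : Set (ι → ℝ)}
    {φ : (ι → ℝ) →ᵃ[ℝ] (Quiver.Total V → ℝ)}
    (hbij : Set.BijOn φ (affineSpan ℝ P : Set (ι → ℝ))
      (affineSpan ℝ (flowPolytope V θ l u) : Set (Quiver.Total V → ℝ)))
    (hlat : φ '' ((affineSpan ℝ P : Set (ι → ℝ)) ∩ integerLattice ι) =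
      (affineSpan ℝ (flowPolytope V θ l u) : Set (Quiver.Total V → ℝ)) ∩
        integerLattice (Quiver.Total V))
    (himg : φ '' P = flowPolytope V θ l u) :
    ∃ G : LatticePoint P → Quiver.Total V → ℤ, (∀ z, intToReal (G z) = φ (intToReal z.1)) ∧
      IsFlowEnumeration (fun a : Quiver.Total V => a.left) (fun a => a.right) θ
        (fun a => (l a : ℤ)) (fun a => (u a : ℤ)) G := by
  have hex : ∀ z : LatticePoint P, ∃ y, intToReal y = φ (intToReal z.1) := fun z =>
    (hlat.subset ⟨_, ⟨mem_affineSpan ℝ z.2, z.1, rfl⟩, rfl⟩).2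
  choose G hG using hex
  refine ⟨G, hG, fun z z' h => ?_, fun y => ?_⟩
  · refine Subtype.ext (intToReal_injective (hbij.injOn (mem_affineSpan ℝ z.2)
      (mem_affineSpan ℝ z'.2) ?_))
    rw [← hG, ← hG, h]
  · rw [← intToReal_mem_flowPolytope_iff]
    constructor
    · rintro ⟨z, rfl⟩
      rw [hG, ← himg]
      exact ⟨_, z.2, rfl⟩
    · intro hy
      -- One preimage of the flow is integral, another lies in `P`; injectivity on the affine span
      -- identifies them.
      obtain ⟨_, ⟨hx, z, rfl⟩, hz⟩ := hlat.superset ⟨mem_affineSpan ℝ hy, y, rfl⟩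
      obtain ⟨x, hxP, hxy⟩ := himg.superset hy
      have hxz : x = intToReal z := hbij.injOn (mem_affineSpan ℝ hxP) hx (hxy.trans hz.symm)
      refine ⟨⟨z, hxz ▸ hxP⟩, intToReal_injective ?_⟩
      exact (hG ⟨z, hxz ▸ hxP⟩).trans hz

theorem IsFlowEnumeration.finite {σ A V : Type*} [Fintype A] [Fintype V] [DecidableEq V]
    {s t : A → V} {θ : V → ℤ} {l u : A → ℤ} {G : σ → A → ℤ}
    (hG : IsFlowEnumeration s t θ l u G) : Finite σ := by
  classical
  have h : ∀ z, G z ∈ Set.Icc l u := fun z =>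
    ⟨fun a => (((hG.mem_range_iff _).1 ⟨z, rfl⟩).2 a).1,
      fun a => (((hG.mem_range_iff _).1 ⟨z, rfl⟩).2 a).2⟩
  have : Finite (Set.Icc l u) := (Set.finite_Icc l u).to_subtype
  exact Finite.of_injective (fun z => (⟨G z, h z⟩ : Set.Icc l u))
    fun z z' h => hG.injective (congrArg Subtype.val h)

/-- Affinely independent points in the image of `P` are at most `dim P + 1` in number. -/
theorem card_le_polytopeDim_add_one {ι κ : Type*} [Fintype ι] {P : Set (ι → ℝ)}
    (φ : (ι → ℝ) →ᵃ[ℝ] (κ → ℝ)) {n : ℕ} {p : Fin n → κ → ℝ} (hp : ∀ i, p i ∈ φ '' P)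
    (hind : AffineIndependent ℝ p) : n ≤ polytopeDim P + 1 := by
  rcases n with _ | n
  · exact Nat.zero_le _
  have hmono := vectorSpan_mono ℝ (Set.range_subset_iff.2 hp)
  rw [← AffineMap.map_vectorSpan] at hmono
  have h1 := hind.finrank_vectorSpan (Fintype.card_fin (n + 1))
  have h2 := Submodule.finrank_mono hmono
  have h3 := Submodule.finrank_map_le φ.linear (vectorSpan ℝ P)
  simp only [polytopeDim]
  omega

end Transport

end FlowToric

/-! ### The proposition -/

theorem mainTheorem3
    (K : Type*) [Field K]
    {V : Type*} [Finite V] [Quiver V] [Fintype (Quiver.Total V)]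
    (hloop : ∀ v : V, IsEmpty (v ⟶ v))
    (θ : V → ℤ) (l u : Quiver.Total V → ℕ)
    {ι : Type uι} [Fintype ι] (P : Set (ι → ℝ))
    (hP : FlowToric.LatticeEquivalent P (FlowToric.flowPolytope V θ l u))
    (d : ℕ) (hd : FlowToric.polytopeDim P = d) :
    ∃ (m : MonomialOrder.{uι, uι} (FlowToric.LatticePoint P))
      (S : Set (FlowToric.LatticePoint P →₀ ℕ)),
      (∀ s ∈ S, (∀ z, s z ≤ 1) ∧ (s.sum fun _ n => n) ≤ if d = 1 then 2 else d) ∧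
      FlowToric.initialIdeal m (FlowToric.toricIdeal K P) =
        Ideal.span ((fun s => MvPolynomial.monomial s (1 : K)) '' S) := by
  classical
  have := Fintype.ofFinite V
  obtain ⟨φ, hbij, hlat, himg⟩ := hP
  obtain ⟨G, hGφ, hG⟩ := FlowToric.LatticeEquivalent.exists_labels hbij hlat himg
  have hfin := hG.finite
  have := Fintype.ofFinite (FlowToric.LatticePoint P)
  -- Any linear order on the variables serves for the tie-break.
  let _ : LinearOrder (FlowToric.LatticePoint P) :=
    LinearOrder.lift' (Fintype.equivFin _) (Fintype.equivFin _).injective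
  have hclass : ∀ α β : FlowToric.LatticePoint P →₀ ℕ,
      FlowToric.classMap (fun z : FlowToric.LatticePoint P => z.1) α =
        FlowToric.classMap (fun z : FlowToric.LatticePoint P => z.1) β ↔
      FlowToric.SameClass G α β := fun α β =>
    (FlowToric.classMap_eq_iff _ α β).trans
      (FlowToric.sameClass_iff_of_affineMap hbij.injOn (fun z => z.2) hGφ α β)
  refine ⟨FlowToric.flowOrder G, {s | FlowToric.Nonstandard G s ∧ (∀ z, s z ≤ 1) ∧
    ∑ z, s z ≤ if d = 1 then 2 else d}, fun s hs => ⟨hs.2.1, ?_⟩, ?_⟩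
  · rw [Finsupp.sum_fintype _ _ fun _ => rfl]
    exact hs.2.2
  · rw [FlowToric.toricIdeal_eq_span]
    refine FlowToric.initialIdeal_span_binomial _ _ _ ?_ ?_
    · rintro s ⟨⟨β, hβ, hlt⟩, -⟩
      exact ⟨β, (hclass β s).2 hβ, hlt⟩
    · intro α β hβ hlt
      obtain ⟨γ, hle, hγ⟩ := hG.exists_squarefree_divisor d (fun n f hf => by
        rw [← hd]
        refine FlowToric.card_le_polytopeDim_add_one φ (fun i => ?_) hf
        exact ⟨_, (f i).2, (hGφ (f i)).symm⟩) ⟨β, (hclass β α).1 hβ, hlt⟩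
      exact ⟨γ, hγ, hle⟩
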